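/- Let $d\ge 1$, $T\ge 2$, and let $\mathcal X\subset\mathbb R^d$ be closed and convex with $r\mathcal B\subseteq\mathcal X\subseteq R\mathcal B$ for some $0<r,R<\infty$, where $\mathcal B$ is the Euclidean unit ball; let $D$ be the diameter of $\mathcal X$. Let $L\ge 0$, $\beta>0$, and let $f_0,f_1,\dots,f_T:\mathcal X\to\mathbb R$ be fixed in advance, each convex, $L$-Lipschitz, differentiable and $\beta$-smooth on $\mathcal X$ (that is, $\|\nabla f_t(x)-\nabla f_t(y)\|\le\beta\|x-y\|$). (The convention $f_0\equiv 0$ is allowed.) Put $$D_T=\sum_{t=1}^T\max_{x\in\mathcal X}\|\nabla f_t(x)-\nabla f_{t-1}(x)\|^2,$$ $$\eta=\min\Big\{\frac{D}{4d^2\sqrt{D_T+1}},\ \frac1{16\beta d^{3/2}\sqrt{\log T}}\Big\},\qquad \delta=\min\Big\{\frac{\sqrt{D_T+1}}{\beta T},\ \frac1{\beta\sqrt T},\ \frac r2\Big\},$$ and $\mathcal X_\alpha=(1-\alpha)\mathcal X$ with $\alpha=\delta/r$; write $\Pi$ for the Euclidean projection onto $\mathcal X_\alpha$. TP-VR-Opt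 with coordinate sampling and the coordinate-persistent predictor starts from any $y_1'\in\mathcal X_\alpha$ and any $m_1\in\mathbb R^d$ with $\|m_1\|\le L$ (for instance $m_1=0$). In round $t=1,\dots,T$ it sets $y_t=\Pi(y_t'-\eta m_t)$, draws $i_t$ uniformly from $\{1,\dots,d\}$ (independently over the rounds), plays $x_t=y_t+\delta e_{i_t}$, computes $$\hat v_t=\frac{f_t(y_t+\delta e_{i_t})-f_t(y_t-\delta e_{i_t})}{2\delta},\qquad \hat g_t=m_t+d\,(\hat v_t-m_{t,i_t})\,e_{i_t},$$ and updates $y_{t+1}'=\Pi(y_t'-\eta\hat g_t)$ and $m_{t+1}=m_t+(\hat v_t-m_{t,i_t})e_{i_t}$. Let $\mathfrak R_T=\sum_{t=1}^Tf_t(x_t)-\min_{x\in\mathcal X}\sum_{t=1}^Tf_t(x)$. Then $\mathbb E[\mathfrak R_T]=\widetilde O\big(Dd^2\sqrt{D_T+1}\big)$, in the following sense: there are universal constants $C>0$ and $k\in\mathbb N$ such that for all data as above $\mathfrak R_T$ is integrable and $$\mathbb E[\mathfrak R_T]\ \le\ C\,\Big(1+L^2+\beta D+\frac{L}{\beta r}\Big)(\log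 T)^k\cdot D\,d^2\sqrt{D_T+1}.$$ In particular, $\mathbb E[\mathfrak R_T]=\widetilde O(Dd^2\sqrt{D_T})$ whenever $D_T\ge 1$, where $\widetilde O$ hides powers of $\log T$ and a factor that depends only on $L,\beta,r,D$ (not on $d$, $T$ or the losses). -/

import Mathlib

open MeasureTheory ProbabilityTheory
open scoped Pointwise ENNReal

noncomputable section

/-- The Euclidean space `ℝ^d`. -/
abbrev Vec (d : ℕ) : Type := EuclideanSpace ℝ (Fin d)

/-- The standard basis vector `e_i`. -/
def basisVec {d : ℕ} (i : Fin d) : Vec d := EuclideanSpace.single i 1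

/-- `p` is a Euclidean projection (nearest point) of `x` onto `K`. -/
def IsNearest {d : ℕ} (K : Set (Vec d)) (x p : Vec d) : Prop :=
  p ∈ K ∧ ∀ z ∈ K, ‖x - p‖ ≤ ‖x - z‖

open Classical in
/-- Euclidean projection `Π_K`; it is only used for nonempty closed convex `K`, where the nearest
point exists and is unique (the value `x` elsewhere is a dummy). -/
def euclProj {d : ℕ} (K : Set (Vec d)) (x : Vec d) : Vec d :=
  if h : ∃ p, IsNearest K x p then h.choose else x

theorem euclProj_isNearest {d : ℕ} {K : Set (Vec d)} (hne : K.Nonempty) (hcl : IsClosed K)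
    (x : Vec d) : IsNearest K x (euclProj K x) := by
  have h : ∃ p, IsNearest K x p := by
    obtain ⟨p, hp, hd⟩ := hcl.exists_infDist_eq_dist hne x
    refine ⟨p, hp, fun z hz => ?_⟩
    rw [← dist_eq_norm, ← dist_eq_norm, ← hd]
    exact Metric.infDist_le_dist_of_mem hz
  unfold euclProj
  rw [dif_pos h]
  exact h.choose_spec

/-- The loss `f : X → ℝ` is convex, `L`-Lipschitz, differentiable and `β`-smooth on `X`. Only the
values of `f` on `X` matter; the gradient is taken relative to `X`. -/
structure IsSmoothLoss {d : ℕ} (X : Set (Vec d)) (L β : ℝ) (f : Vec d → ℝ) : Prop where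
  convex : ConvexOn ℝ X f
  lipschitz : ∀ x ∈ X, ∀ y ∈ X, |f x - f y| ≤ L * ‖x - y‖
  differentiable : DifferentiableOn ℝ f X
  smooth : ∀ x ∈ X, ∀ y ∈ X, ‖gradientWithin f X x - gradientWithin f X y‖ ≤ β * ‖x - y‖

/-- The gradient variation `D_T = ∑_{t=1}^T max_{x ∈ X} ‖∇f_t(x) - ∇f_{t-1}(x)‖²`. -/
def gradVariation {d : ℕ} (X : Set (Vec d)) (f : ℕ → Vec d → ℝ) (T : ℕ) : ℝ :=
  ∑ t ∈ Finset.Icc 1 T,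
    sSup ((fun x => ‖gradientWithin (f t) X x - gradientWithin (f (t - 1)) X x‖ ^ 2) '' X)

/-- The shrunk decision set `X_α = (1 - α) X` with `α = δ / r`. -/
def shrunkSet {d : ℕ} (X : Set (Vec d)) (r δ : ℝ) : Set (Vec d) := (1 - δ / r) • X

/-- State of the learner at the start of a round `t`: the auxiliary point `y'_t` and the
prediction `m_t`. -/
structure LearnerState (d : ℕ) where
  aux : Vec d
  pred : Vec d

/-- The center point `y_t = Π_K (y'_t - η m_t)`. -/
def centerPoint {d : ℕ} (K : Set (Vec d)) (η : ℝ) (s : LearnerState d) : Vec d :=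
  euclProj K (s.aux - η • s.pred)

/-- The two-point finite-difference slope `(g (y + δ e_i) - g (y - δ e_i)) / (2 δ)`. -/
def fdSlope {d : ℕ} (g : Vec d → ℝ) (δ : ℝ) (y : Vec d) (i : Fin d) : ℝ :=
  (g (y + δ • basisVec i) - g (y - δ • basisVec i)) / (2 * δ)

/-- The variance-reduced estimator `ĝ_t = m_t + d (v̂_{t,i} - m_{t,i}) e_i`. -/
def gradEstimate {d : ℕ} (K : Set (Vec d)) (η δ : ℝ) (g : Vec d → ℝ) (i : Fin d)
    (s : LearnerState d) : Vec d :=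
  s.pred + ((d : ℝ) * (fdSlope g δ (centerPoint K η s) i - s.pred i)) • basisVec i

/-- One round with loss `g` and sampled coordinate `i`:
`y'_{t+1} = Π_K (y'_t - η ĝ_t)` and `m_{t+1} = m_t + (v̂_{t,i} - m_{t,i}) e_i`. -/
def learnerStep {d : ℕ} (K : Set (Vec d)) (η δ : ℝ) (g : Vec d → ℝ) (i : Fin d)
    (s : LearnerState d) : LearnerState d where
  aux := euclProj K (s.aux - η • gradEstimate K η δ g i s)
  pred := s.pred + (fdSlope g δ (centerPoint K η s) i - s.pred i) • basisVec i

/-- The state at the start of round `t` (rounds are numbered `1, 2, …`; index `0` is a dummy), for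
the losses `f t` and the sampled coordinates `ι t`. -/
def roundState {d : ℕ} (K : Set (Vec d)) (η δ : ℝ) (f : ℕ → Vec d → ℝ) (s₁ : LearnerState d)
    (ι : ℕ → Fin d) : ℕ → LearnerState d
  | 0 => s₁
  | 1 => s₁
  | t + 2 => learnerStep K η δ (f (t + 1)) (ι (t + 1)) (roundState K η δ f s₁ ι (t + 1))

/-- The point `x_t = y_t + δ e_{i_t}` played in round `t`. -/
def playedPoint {d : ℕ} (K : Set (Vec d)) (η δ : ℝ) (f : ℕ → Vec d → ℝ) (s₁ : LearnerState d)
    (ι : ℕ → Fin d) (t : ℕ) : Vec d :=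
  centerPoint K η (roundState K η δ f s₁ ι t) + δ • basisVec (ι t)

/-- The regret `∑_{t=1}^T f_t(x_t) - min_{x ∈ X} ∑_{t=1}^T f_t(x)` of TP-VR-Opt with coordinate
sampling and the coordinate-persistent predictor, started at `y'_1`, `m_1`, as a function of the
sampled coordinates `ι 1, …, ι T`. -/
def coordRegret {d : ℕ} (X : Set (Vec d)) (r η δ : ℝ) (f : ℕ → Vec d → ℝ) (y₁ m₁ : Vec d)
    (T : ℕ) (ι : ℕ → Fin d) : ℝ :=
  (∑ t ∈ Finset.Icc 1 T, f t (playedPoint (shrunkSet X r δ) η δ f ⟨y₁, m₁⟩ ι t))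
    - sInf ((fun x => ∑ t ∈ Finset.Icc 1 T, f t x) '' X)

/-- The oracle step size
`η = min {D / (4 d² √(D_T + 1)), 1 / (16 β d^{3/2} √(log T))}`; here `V` is `D_T`. -/
def oracleStep (d T : ℕ) (D β V : ℝ) : ℝ :=
  min (D / (4 * (d : ℝ) ^ 2 * √(V + 1)))
    (1 / (16 * β * (d : ℝ) ^ ((3 : ℝ) / 2) * √(Real.log T)))

/-- The oracle perturbation radius
`δ = min {√(D_T + 1) / (β T), 1 / (β √T), r / 2}`; here `V` is `D_T`. -/
def oracleRadius (T : ℕ) (r β V : ℝ) : ℝ :=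
  min (√(V + 1) / (β * T)) (min (1 / (β * √T)) (r / 2))

end

/-! ### Projections and one step of optimistic mirror descent -/

/-! The losses are fixed in advance, so the comparator can be fixed too: take `x ∈ X` and its shrunk
copy `u = (1 - α) x`. Passing from `x` to `u`, from the played point to the center `y_t`, and from
the gradient to the vector `v_t` of finite differences costs only `L α D + L δ + √d β δ D` per
round. What remains is the linear regret of optimistic mirror descent driven by `ĝ_t`, whose average
over the sampled coordinate is `v_t` (`sum_inner_coordEstimate`).

The optimistic step (`optimistic_step_inner_le`) charges `η ‖ĝ_t - m_t‖²`, on average `η d ‖v_t -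
m_t‖²`, and gives back negative movement terms. Refreshing one random coordinate of the predictor
shrinks its squared error by `1 - 1/d` on average, while replacing `v_t` by `v_{t+1}` adds a drift
controlled by the gradient change, the movement `‖y_{t+1} - y_t‖²` and the finite-difference bias.
Adding the squared error with weight `2 η d²` to the distance to `u` gives a potential: its average
contraction pays for the variance, and the negative movement terms absorb the drift due to movement
once `144 η² β² d³ ≤ 1` (`sum_inner_gradEstimate_add_potential_le`). Only the gradient changes, with
weight `24 η d³`, and the bias survive.

The one-round inequality holds at every learner state, so no conditional expectations are needed:
the expectation is a finite average over coordinate sequences, telescoped by resampling one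
coordinate at a time (`sum_cost_le_of_potential`). Inserting the oracle parameters is then
arithmetic (`regret_bound_le`). -/

theorem IsNearest.inner_le_zero {d : ℕ} {K : Set (Vec d)} (hK : Convex ℝ K) {x p z : Vec d}
    (h : IsNearest K x p) (hz : z ∈ K) : inner ℝ (x - p) (z - p) ≤ 0 := by
  refine (norm_eq_iInf_iff_real_inner_le_zero hK h.1).1 ?_ z hz
  have : Nonempty K := ⟨⟨p, h.1⟩⟩
  refine le_antisymm (le_ciInf fun w => h.2 w w.2) ?_
  exact ciInf_le ⟨0, by rintro _ ⟨w, rfl⟩; exact norm_nonneg _⟩ (⟨p, h.1⟩ : K)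

/-- Split `⟨g, y - u⟩ = ⟨g, p - u⟩ + ⟨m, y - p⟩ + ⟨g - m, y - p⟩`. The first two terms are bounded
by the variational inequalities of the two projections, tested at `u` and at `p`. Young's inequality
for the third, in the form of the square `h3`, uses up half of the available `‖p - y‖² / (2η)`. The
point `a` need not lie in `K`. -/
theorem optimistic_step_inner_le {d : ℕ} {K : Set (Vec d)} (hK : Convex ℝ K)
    {η : ℝ} (hη : 0 < η) {a m g y p u : Vec d} (hy : IsNearest K (a - η • m) y)
    (hp : IsNearest K (a - η • g) p) (hu : u ∈ K) :
    inner ℝ g (y - u) ≤ (‖a - u‖ ^ 2 - ‖p - u‖ ^ 2) / (2 * η) + η * ‖g - m‖ ^ 2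
      - ‖y - a‖ ^ 2 / (2 * η) - ‖p - y‖ ^ 2 / (4 * η) := by
  have h1 := hy.inner_le_zero hK hp.1
  have h2 := hp.inner_le_zero hK hu
  have h3 : 0 ≤ ‖(2 * η) • (g - m) + (p - y)‖ ^ 2 := sq_nonneg _
  have e1 : a - η • m - y = -(y - a) - η • m := by abel
  have e2 : a - η • g - p = -(p - y) - (y - a) - η • g := by abel
  have e3 : u - p = -(p - y) - (y - u) := by abel
  have e4 : a - u = (y - u) - (y - a) := by abel
  have e5 : p - u = (y - u) + (p - y) := by abel
  rw [e1] at h1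
  rw [e2, e3] at h2
  rw [e4, e5]
  generalize y - a = α at *
  generalize p - y = γ at *
  generalize y - u = υ at *
  have key : 4 * η * inner ℝ g υ ≤ 2 * (‖υ - α‖ ^ 2 - ‖υ + γ‖ ^ 2) + 4 * η ^ 2 * ‖g - m‖ ^ 2
      - 2 * ‖α‖ ^ 2 - ‖γ‖ ^ 2 := by
    rw [norm_add_sq_real, norm_smul, Real.norm_of_nonneg (by positivity)] at h3
    rw [norm_add_sq_real, norm_sub_sq_real υ α]
    simp only [inner_sub_left, inner_sub_right, inner_neg_left, inner_neg_right,
      real_inner_smul_left, real_inner_self_eq_norm_sq] at h1 h2 h3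
    rw [real_inner_comm α υ, real_inner_comm γ υ]
    nlinarith
  have h4 : inner ℝ g υ ≤ (2 * (‖υ - α‖ ^ 2 - ‖υ + γ‖ ^ 2) + 4 * η ^ 2 * ‖g - m‖ ^ 2
      - 2 * ‖α‖ ^ 2 - ‖γ‖ ^ 2) / (4 * η) := by
    rw [le_div_iff₀ (by positivity)]
    linarith
  refine h4.trans (le_of_eq ?_)
  field_simp
  ring

/-! ### Smooth losses -/

theorem IsSmoothLoss.hasDerivWithinAt_line {d : ℕ} {X : Set (Vec d)} {L β : ℝ} {f : Vec d → ℝ}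
    (hf : IsSmoothLoss X L β f) {y v : Vec d} {S : Set ℝ} (hS : ∀ s ∈ S, y + s • v ∈ X) {s : ℝ}
    (hs : s ∈ S) : HasDerivWithinAt (fun s : ℝ => f (y + s • v))
      (inner ℝ (gradientWithin f X (y + s • v)) v) S s := by
  have h1 := (hf.differentiable _ (hS s hs)).hasGradientWithinAt.hasFDerivWithinAt
  have h2 : HasDerivWithinAt (fun s : ℝ => y + s • v) v S s := by
    simpa using ((hasDerivWithinAt_id s S).smul_const v).const_add y
  have h3 := h1.comp_hasDerivWithinAt s h2 hS
  simpa [Function.comp_def] using h3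

theorem IsSmoothLoss.sub_le_inner {d : ℕ} {X : Set (Vec d)} {L β : ℝ} {f : Vec d → ℝ}
    (hX : Convex ℝ X) (hf : IsSmoothLoss X L β f) {y u : Vec d} (hy : y ∈ X) (hu : u ∈ X) :
    f y - f u ≤ inner ℝ (gradientWithin f X y) (y - u) := by
  have hS : ∀ s ∈ Set.Icc (0 : ℝ) 1, y + s • (u - y) ∈ X := fun s hs =>
    hX.add_smul_sub_mem hy hu hs
  have h1 := hf.hasDerivWithinAt_line hS (s := 0) (by simp)
  have hc : ConvexOn ℝ (Set.Icc (0 : ℝ) 1) (fun s : ℝ => f (y + s • (u - y))) := by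
    have h := (hf.convex.comp_affineMap (AffineMap.lineMap y u : ℝ →ᵃ[ℝ] Vec d)).subset
      (s := Set.Icc (0 : ℝ) 1) (fun s hs => by
        simpa [AffineMap.lineMap_apply, add_comm] using hS s hs) (convex_Icc 0 1)
    refine h.congr fun s _ => ?_
    simp [AffineMap.lineMap_apply, add_comm]
  have h2 := hc.le_slope_of_hasDerivWithinAt (by simp) (by simp) zero_lt_one h1
  simp only [slope_def_field, zero_smul, one_smul, add_zero, add_sub_cancel, sub_zero,
    div_one] at h2
  rw [← neg_sub u y, inner_neg_right]
  linarith

/-- By the mean value theorem the slope is the directional derivative at some point of the segment,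
at distance at most `δ` from `y`, where smoothness applies. -/
theorem IsSmoothLoss.abs_fdSlope_sub_le {d : ℕ} {X : Set (Vec d)} {L β : ℝ} {f : Vec d → ℝ}
    (hX : Convex ℝ X) (hf : IsSmoothLoss X L β f) {δ : ℝ} (hδ : 0 < δ) (hβ : 0 < β) {y : Vec d}
    {i : Fin d} (hp : y + δ • basisVec i ∈ X) (hm : y - δ • basisVec i ∈ X) :
    |fdSlope f δ y i - gradientWithin f X y i| ≤ β * δ := by
  have hS : ∀ s ∈ Set.Icc (-δ) δ, y + s • (basisVec i : Vec d) ∈ X := by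
    intro s hs
    have h := hX.add_smul_sub_mem hm hp (t := (s + δ) / (2 * δ))
      ⟨by have := hs.1; apply div_nonneg <;> linarith, by
        rw [div_le_one (by positivity)]; have := hs.2; linarith⟩
    convert h using 1
    have h2 : y + δ • basisVec i - (y - δ • basisVec i) = (2 * δ) • basisVec i := by module
    rw [h2, smul_smul, div_mul_cancel₀ _ (by positivity)]
    module
  obtain ⟨c, hc, hcs⟩ := exists_hasDerivAt_eq_slope (fun s : ℝ => f (y + s • basisVec i))
    (fun s => inner ℝ (gradientWithin f X (y + s • basisVec i)) (basisVec i))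
    (show -δ < δ by linarith)
    (fun s hs => (hf.hasDerivWithinAt_line hS hs).continuousWithinAt)
    (fun s hs => (hf.hasDerivWithinAt_line hS ⟨hs.1.le, hs.2.le⟩).hasDerivAt
      (Icc_mem_nhds hs.1 hs.2))
  have hb : ‖(basisVec i : Vec d)‖ = 1 := by simp [basisVec]
  have hy : y ∈ X := by simpa using hS 0 ⟨by linarith, hδ.le⟩
  have e : fdSlope f δ y i = inner ℝ (gradientWithin f X (y + c • basisVec i)) (basisVec i) := by
    rw [hcs, fdSlope]
    simp only [neg_smul, ← sub_eq_add_neg, sub_neg_eq_add]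
    ring_nf
  have e2 : gradientWithin f X y i = inner ℝ (gradientWithin f X y) (basisVec i) := by
    rw [basisVec, EuclideanSpace.inner_single_right]
    simp
  rw [e, e2, ← inner_sub_left]
  refine (abs_real_inner_le_norm _ _).trans ?_
  rw [hb, mul_one]
  refine (hf.smooth _ (hS c ⟨hc.1.le, hc.2.le⟩) _ hy).trans ?_
  rw [add_sub_cancel_left, norm_smul, hb, mul_one, Real.norm_eq_abs]
  exact mul_le_mul_of_nonneg_left (abs_le.2 ⟨hc.1.le, hc.2.le⟩) hβ.le

/-- The vector of all finite-difference slopes at `y`. -/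
noncomputable def fdVec {d : ℕ} (g : Vec d → ℝ) (δ : ℝ) (y : Vec d) : Vec d :=
  WithLp.toLp 2 fun i => fdSlope g δ y i

theorem norm_sq_le_card_mul {d : ℕ} {v : Vec d} {c : ℝ} (h : ∀ i, |v i| ≤ c) :
    ‖v‖ ^ 2 ≤ d * c ^ 2 := by
  rw [EuclideanSpace.norm_sq_eq]
  calc ∑ i, ‖v i‖ ^ 2 ≤ ∑ _i : Fin d, c ^ 2 :=
        Finset.sum_le_sum fun i _ => pow_le_pow_left₀ (norm_nonneg _) (h i) 2
    _ = d * c ^ 2 := by simp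

theorem IsSmoothLoss.norm_fdVec_sub_sq_le {d : ℕ} {X : Set (Vec d)} {L β : ℝ} {f : Vec d → ℝ}
    (hX : Convex ℝ X) (hf : IsSmoothLoss X L β f) {δ : ℝ} (hδ : 0 < δ) (hβ : 0 < β) {y : Vec d}
    (hp : ∀ i, y + δ • basisVec i ∈ X) (hm : ∀ i, y - δ • basisVec i ∈ X) :
    ‖fdVec f δ y - gradientWithin f X y‖ ^ 2 ≤ d * (β * δ) ^ 2 :=
  norm_sq_le_card_mul fun i => hf.abs_fdSlope_sub_le hX hδ hβ (hp i) (hm i)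

theorem IsSmoothLoss.norm_fdVec_sq_le {d : ℕ} {X : Set (Vec d)} {L β : ℝ} {f : Vec d → ℝ}
    (hf : IsSmoothLoss X L β f) {δ : ℝ} (hδ : 0 < δ) {y : Vec d}
    (hp : ∀ i, y + δ • basisVec i ∈ X) (hm : ∀ i, y - δ • basisVec i ∈ X) :
    ‖fdVec f δ y‖ ^ 2 ≤ d * L ^ 2 := by
  refine norm_sq_le_card_mul fun i => ?_
  have h := hf.lipschitz _ (hp i) _ (hm i)
  have e : y + δ • basisVec i - (y - δ • basisVec i) = (2 * δ) • (basisVec i : Vec d) := by module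
  have hb : ‖(basisVec i : Vec d)‖ = 1 := by simp [basisVec]
  rw [e, norm_smul, hb, mul_one, Real.norm_of_nonneg (by positivity)] at h
  change |fdSlope f δ y i| ≤ L
  rw [fdSlope, abs_div, abs_of_pos (show 0 < 2 * δ by positivity), div_le_iff₀ (by positivity)]
  exact h

/-! ### Averages over the sampled coordinate -/

/-- Unbiasedness: the factor `d` cancels the probability `1/d` of drawing each coordinate. -/
theorem sum_inner_coordEstimate {d : ℕ} (m v w : Vec d) :
    ∑ i : Fin d, inner ℝ (m + ((d : ℝ) * (v i - m i)) • basisVec i) w = d * inner ℝ v w := by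
  have h : ∀ i : Fin d, inner ℝ (m + ((d : ℝ) * (v i - m i)) • basisVec i) w
      = inner ℝ m w + d * (w i * (v i - m i)) := by
    intro i
    rw [inner_add_left, real_inner_smul_left, basisVec, EuclideanSpace.inner_single_left]
    simp
    ring
  have h2 : inner ℝ (v - m) w = ∑ i : Fin d, w i * (v i - m i) := by
    simp [PiLp.inner_apply]
  rw [Finset.sum_congr rfl fun i _ => h i, Finset.sum_add_distrib, ← Finset.mul_sum, ← h2,
    inner_sub_left]
  simp
  ring

theorem norm_sq_smul_basisVec {d : ℕ} (c : ℝ) (i : Fin d) :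
    ‖c • (basisVec i : Vec d)‖ ^ 2 = c ^ 2 := by
  simp [norm_smul, basisVec]

theorem sum_norm_sq_coordEstimate {d : ℕ} (m v : Vec d) :
    ∑ i : Fin d, ‖((d : ℝ) * (v i - m i)) • (basisVec i : Vec d)‖ ^ 2
      = d ^ 2 * ‖v - m‖ ^ 2 := by
  simp only [norm_sq_smul_basisVec, mul_pow]
  rw [← Finset.mul_sum, EuclideanSpace.norm_sq_eq]
  simp

/-- The update makes coordinate `i` exact, removing `(v i - m i)²` from the squared error. Summed
over `i`, the removed parts make up one full error. -/
theorem sum_norm_sq_coordUpdate {d : ℕ} (m v : Vec d) :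
    ∑ i : Fin d, ‖v - (m + (v i - m i) • basisVec i)‖ ^ 2 = (d - 1) * ‖v - m‖ ^ 2 := by
  have h : ∀ i : Fin d, ‖v - (m + (v i - m i) • basisVec i)‖ ^ 2
      = ‖v - m‖ ^ 2 - ‖(v - m) i‖ ^ 2 := by
    intro i
    rw [← sub_sub, norm_sub_sq_real, norm_sq_smul_basisVec, real_inner_smul_right, basisVec,
      EuclideanSpace.inner_single_right]
    simp
    ring
  rw [Finset.sum_congr rfl fun i _ => h i, Finset.sum_sub_distrib, ← EuclideanSpace.norm_sq_eq]
  simp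
  ring

/-! ### Averaging over the sampled coordinates -/

/-- Resampling one coordinate preserves the uniform average: exchanging the fresh value with the old
one is an involution of the pairs. -/
theorem sum_sum_update {α β : Type*} [Fintype α] [DecidableEq α] [Fintype β] (a : α)
    (F : (α → β) → ℝ) :
    ∑ x : α → β, ∑ b : β, F (Function.update x a b) = Fintype.card β * ∑ x : α → β, F x := by
  have h : Function.Involutive
      (fun p : (α → β) × β => (Function.update p.1 a p.2, p.1 a)) := by
    rintro ⟨x, b⟩
    simp
  calc ∑ x : α → β, ∑ b : β, F (Function.update x a b)
      = ∑ p : (α → β) × β, F (Function.update p.1 a p.2) := by rw [Fintype.sum_prod_type]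
    _ = ∑ p : (α → β) × β, F p.1 :=
        Fintype.sum_bijective _ h.bijective _ _ fun _ => rfl
    _ = Fintype.card β * ∑ x : α → β, F x := by
        rw [Fintype.sum_prod_type, Finset.mul_sum]
        simp

theorem roundState_congr {d : ℕ} {K : Set (Vec d)} {η δ : ℝ} {f : ℕ → Vec d → ℝ}
    {s₁ : LearnerState d} {ι ι' : ℕ → Fin d} :
    ∀ {t : ℕ}, (∀ s, 1 ≤ s → s < t → ι s = ι' s) →
      roundState K η δ f s₁ ι t = roundState K η δ f s₁ ι' t
  | 0, _ => rfl
  | 1, _ => rfl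
  | t + 2, h => by
    rw [roundState, roundState, h (t + 1) (by omega) (by omega),
      roundState_congr fun s h1 h2 => h s h1 (by omega)]

/-- Extend a choice of coordinates for the rounds `1, …, T` by a constant. -/
def extendChoice {d T : ℕ} (j₀ : Fin d) (x : Finset.Icc 1 T → Fin d) (t : ℕ) : Fin d :=
  if h : t ∈ Finset.Icc 1 T then x ⟨t, h⟩ else j₀

theorem extendChoice_of_mem {d T : ℕ} (j₀ : Fin d) (x : Finset.Icc 1 T → Fin d) {t : ℕ}
    (h : t ∈ Finset.Icc 1 T) : extendChoice j₀ x t = x ⟨t, h⟩ := dif_pos h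

theorem extendChoice_update_of_ne {d T : ℕ} (j₀ j : Fin d) (x : Finset.Icc 1 T → Fin d)
    (a : Finset.Icc 1 T) {t : ℕ} (h : t ≠ a) :
    extendChoice j₀ (Function.update x a j) t = extendChoice j₀ x t := by
  unfold extendChoice
  split_ifs with ht
  · rw [Function.update_of_ne]
    rintro rfl
    exact h rfl
  · rfl

/-- If a potential pays for the average cost of every round, it pays for the average total cost. -/
theorem sum_cost_le_of_potential {d T : ℕ} (j₀ : Fin d) (K : Set (Vec d)) (η δ : ℝ)
    (f : ℕ → Vec d → ℝ) (s₁ : LearnerState d) (cost : ℕ → LearnerState d → Fin d → ℝ)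
    (Φ : ℕ → LearnerState d → ℝ) (c : ℕ → ℝ)
    (hstep : ∀ t ∈ Finset.Icc 1 T, ∀ s,
      ∑ j, (cost t s j + Φ (t + 1) (learnerStep K η δ (f t) j s)) ≤ d * (Φ t s + c t))
    (n : ℕ) (hn : n ≤ T) :
    ∑ x : Finset.Icc 1 T → Fin d,
        (∑ t ∈ Finset.Icc 1 n, cost t (roundState K η δ f s₁ (extendChoice j₀ x) t)
            (extendChoice j₀ x t)
          + Φ (n + 1) (roundState K η δ f s₁ (extendChoice j₀ x) (n + 1)))
      ≤ ∑ _x : Finset.Icc 1 T → Fin d, (Φ 1 s₁ + ∑ t ∈ Finset.Icc 1 n, c t) := by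
  have hd : (0 : ℝ) < d := by
    have := j₀.pos
    exact_mod_cast this
  induction n with
  | zero => simp [roundState]
  | succ n ih =>
    have hmem : n + 1 ∈ Finset.Icc 1 T := Finset.mem_Icc.2 ⟨by omega, hn⟩
    refine le_of_mul_le_mul_left ?_ hd
    -- Resample the coordinate of round `n + 1`. The state at the start of that round and all
    -- earlier costs do not depend on it, so the inner sum over `j` is exactly the one in `hstep`.
    have hup := sum_sum_update (⟨n + 1, hmem⟩ : Finset.Icc 1 T)
      (fun x : Finset.Icc 1 T → Fin d =>
        ∑ t ∈ Finset.Icc 1 (n + 1), cost t (roundState K η δ f s₁ (extendChoice j₀ x) t)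
            (extendChoice j₀ x t)
          + Φ (n + 1 + 1) (roundState K η δ f s₁ (extendChoice j₀ x) (n + 1 + 1)))
    rw [Fintype.card_fin] at hup
    rw [← hup]
    calc _ ≤ ∑ x : Finset.Icc 1 T → Fin d, d *
          ((∑ t ∈ Finset.Icc 1 n, cost t (roundState K η δ f s₁ (extendChoice j₀ x) t)
              (extendChoice j₀ x t)
            + Φ (n + 1) (roundState K η δ f s₁ (extendChoice j₀ x) (n + 1))) + c (n + 1)) := by
          refine Finset.sum_le_sum fun x _ => ?_
          have hS : ∀ j t, t ≤ n + 1 → roundState K η δ f s₁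
              (extendChoice j₀ (Function.update x ⟨n + 1, hmem⟩ j)) t
              = roundState K η δ f s₁ (extendChoice j₀ x) t := fun j t ht =>
            roundState_congr fun s _ h2 =>
              extendChoice_update_of_ne _ _ _ _ (show s ≠ n + 1 by omega)
          have hj : ∀ j, extendChoice j₀ (Function.update x ⟨n + 1, hmem⟩ j) (n + 1) = j := by
            intro j
            rw [extendChoice_of_mem _ _ hmem, Function.update_self]
          have hsum : ∀ j, ∑ t ∈ Finset.Icc 1 n, cost t (roundState K η δ f s₁
                (extendChoice j₀ (Function.update x ⟨n + 1, hmem⟩ j)) t)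
                (extendChoice j₀ (Function.update x ⟨n + 1, hmem⟩ j) t)
              = ∑ t ∈ Finset.Icc 1 n, cost t (roundState K η δ f s₁ (extendChoice j₀ x) t)
                (extendChoice j₀ x t) := by
            intro j
            refine Finset.sum_congr rfl fun t ht => ?_
            have ht' := (Finset.mem_Icc.1 ht).2
            rw [hS j t (by omega),
              extendChoice_update_of_ne _ _ _ _ (show t ≠ n + 1 by omega)]
          have h := hstep (n + 1) hmem (roundState K η δ f s₁ (extendChoice j₀ x) (n + 1))
          simp only [Finset.sum_Icc_succ_top (show 1 ≤ n + 1 by omega), hsum, hj,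
            hS _ (n + 1) le_rfl, roundState]
          simp only [add_assoc] at h ⊢
          rw [Finset.sum_add_distrib]
          simp only [Finset.sum_const, Finset.card_univ, Fintype.card_fin, nsmul_eq_mul]
          linarith
      _ ≤ _ := by
          rw [← Finset.mul_sum, Finset.sum_add_distrib]
          refine mul_le_mul_of_nonneg_left ?_ hd.le
          refine (add_le_add_left (ih (by omega)) _).trans (le_of_eq ?_)
          rw [← Finset.sum_add_distrib, Finset.sum_Icc_succ_top (by omega)]
          simp only [add_assoc]

/-- A function of independent uniform coordinates is integrable and its expectation is the
average over all choices. -/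
theorem integral_uniform_choice {α Ω : Type*} [Fintype α] [DecidableEq α] {d : ℕ}
    [MeasurableSpace Ω] (μ : Measure Ω) [IsProbabilityMeasure μ] (Y : α → Ω → Fin d)
    (hm : ∀ a, Measurable (Y a)) (hind : iIndepFun Y μ)
    (hu : ∀ a j, μ (Y a ⁻¹' {j}) = (d : ℝ≥0∞)⁻¹) (G : (α → Fin d) → ℝ) :
    Integrable (fun ω => G fun a => Y a ω) μ ∧
      ∫ ω, G (fun a => Y a ω) ∂μ = (Fintype.card (α → Fin d) : ℝ)⁻¹ * ∑ x, G x := by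
  have hY : Measurable fun ω a => Y a ω := measurable_pi_lambda _ hm
  have : IsProbabilityMeasure (μ.map fun ω a => Y a ω) :=
    Measure.isProbabilityMeasure_map hY.aemeasurable
  have hG : Integrable G (μ.map fun ω a => Y a ω) := Integrable.of_finite
  refine ⟨hG.comp_measurable hY, ?_⟩
  have hpt : ∀ x : α → Fin d, (μ.map fun ω a => Y a ω).real {x}
      = (Fintype.card (α → Fin d) : ℝ)⁻¹ := by
    intro x
    have hset : (fun ω a => Y a ω) ⁻¹' {x} = ⋂ a ∈ Finset.univ, Y a ⁻¹' {x a} := by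
      ext ω
      simp [funext_iff]
    rw [measureReal_def, Measure.map_apply hY (measurableSet_singleton _), hset,
      hind.measure_inter_preimage_eq_mul _ fun a _ => measurableSet_singleton _]
    simp [hu]
  rw [← integral_map hY.aemeasurable hG.aestronglyMeasurable, integral_fintype hG,
    Finset.mul_sum]
  simp [hpt]

/-! ### The potential -/

theorem norm_add_sq_le_young {E : Type*} [NormedAddCommGroup E] [InnerProductSpace ℝ E] {θ : ℝ}
    (hθ : 0 < θ) (a b : E) : ‖a + b‖ ^ 2 ≤ (1 + θ) * ‖a‖ ^ 2 + (1 + 1 / θ) * ‖b‖ ^ 2 := by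
  have h1 := norm_add_le a b
  have h2 : ‖a + b‖ ^ 2 ≤ (‖a‖ + ‖b‖) ^ 2 := pow_le_pow_left₀ (norm_nonneg _) h1 2
  have h3 : 0 ≤ (θ * ‖a‖ - ‖b‖) ^ 2 / θ := by positivity
  have h4 : (θ * ‖a‖ - ‖b‖) ^ 2 / θ = θ * ‖a‖ ^ 2 - 2 * ‖a‖ * ‖b‖ + 1 / θ * ‖b‖ ^ 2 := by
    field_simp
    ring
  nlinarith

theorem norm_add_four_sq_le {E : Type*} [NormedAddCommGroup E] [InnerProductSpace ℝ E]
    (a b c e : E) :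
    ‖a + b + c + e‖ ^ 2 ≤ 4 * (‖a‖ ^ 2 + ‖b‖ ^ 2 + ‖c‖ ^ 2 + ‖e‖ ^ 2) := by
  have h1 := norm_add_sq_le_young one_pos (a + b) (c + e)
  have h2 := norm_add_sq_le_young one_pos a b
  have h3 := norm_add_sq_le_young one_pos c e
  rw [← add_assoc] at h1
  linarith

/-- The difference quotients at points of `K` only query the loss on `X`. -/
structure IsInnerSet {d : ℕ} (X K : Set (Vec d)) (δ : ℝ) : Prop where
  convex : Convex ℝ K
  isClosed : IsClosed K
  nonempty : K.Nonempty
  subset : K ⊆ X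
  add_mem : ∀ y ∈ K, ∀ i, y + δ • basisVec i ∈ X
  sub_mem : ∀ y ∈ K, ∀ i, y - δ • basisVec i ∈ X

theorem IsInnerSet.isNearest {d : ℕ} {X K : Set (Vec d)} {δ : ℝ} (h : IsInnerSet X K δ)
    (x : Vec d) : IsNearest K x (euclProj K x) :=
  euclProj_isNearest h.nonempty h.isClosed x

/-- Go through the gradients: two finite-difference biases, one change of loss at `z`, and one
movement from `z` to `y` under the same loss. -/
theorem norm_fdVec_sub_fdVec_sq_le {d : ℕ} {X K : Set (Vec d)} {L β δ G : ℝ} {f g : Vec d → ℝ}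
    (hX : Convex ℝ X) (hK : IsInnerSet X K δ) (hf : IsSmoothLoss X L β f)
    (hg : IsSmoothLoss X L β g) (hδ : 0 < δ) (hβ : 0 < β)
    (hG : ∀ x ∈ X, ‖gradientWithin g X x - gradientWithin f X x‖ ^ 2 ≤ G) {y z : Vec d}
    (hy : y ∈ K) (hz : z ∈ K) :
    ‖fdVec g δ z - fdVec f δ y‖ ^ 2 ≤ 4 * (2 * (d * (β * δ) ^ 2) + G + β ^ 2 * ‖z - y‖ ^ 2) := by
  have h1 := hg.norm_fdVec_sub_sq_le hX hδ hβ (hK.add_mem z hz) (hK.sub_mem z hz)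
  have h2 := hf.norm_fdVec_sub_sq_le hX hδ hβ (hK.add_mem y hy) (hK.sub_mem y hy)
  have h3 := hG z (hK.subset hz)
  have h4 := pow_le_pow_left₀ (norm_nonneg _)
    (hf.smooth z (hK.subset hz) y (hK.subset hy)) 2
  have e : fdVec g δ z - fdVec f δ y = (fdVec g δ z - gradientWithin g X z)
      + (gradientWithin g X z - gradientWithin f X z)
      + (gradientWithin f X z - gradientWithin f X y)
      + (gradientWithin f X y - fdVec f δ y) := by abel
  rw [e]
  refine (norm_add_four_sq_le _ _ _ _).trans ?_
  rw [norm_sub_rev (gradientWithin f X y), mul_pow] at *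
  linarith

/-- The potential: distance to the comparator `u`, plus the prediction error, minus the movement
already paid for. -/
noncomputable def potential {d : ℕ} (K : Set (Vec d)) (η δ : ℝ) (u : Vec d) (f : Vec d → ℝ)
    (s : LearnerState d) : ℝ :=
  ‖s.aux - u‖ ^ 2 / (2 * η) + 2 * η * d ^ 2 * ‖fdVec f δ (centerPoint K η s) - s.pred‖ ^ 2
    - ‖centerPoint K η s - s.aux‖ ^ 2 / (2 * η)

theorem gradEstimate_eq {d : ℕ} (K : Set (Vec d)) (η δ : ℝ) (f : Vec d → ℝ) (j : Fin d)
    (s : LearnerState d) : gradEstimate K η δ f j s = s.pred +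
      ((d : ℝ) * (fdVec f δ (centerPoint K η s) j - s.pred j)) • basisVec j := rfl

theorem inner_gradEstimate_le {d : ℕ} {X K : Set (Vec d)} {δ η : ℝ} (hK : IsInnerSet X K δ)
    (hη : 0 < η) (f : Vec d → ℝ) {u : Vec d} (hu : u ∈ K) (s : LearnerState d) (j : Fin d) :
    inner ℝ (gradEstimate K η δ f j s) (centerPoint K η s - u)
      ≤ (‖s.aux - u‖ ^ 2 - ‖(learnerStep K η δ f j s).aux - u‖ ^ 2) / (2 * η)
        + η * ‖((d : ℝ) * (fdVec f δ (centerPoint K η s) j - s.pred j)) •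
            (basisVec j : Vec d)‖ ^ 2
        - ‖centerPoint K η s - s.aux‖ ^ 2 / (2 * η)
        - ‖(learnerStep K η δ f j s).aux - centerPoint K η s‖ ^ 2 / (4 * η) := by
  have h := optimistic_step_inner_le hK.convex hη (hK.isNearest (s.aux - η • s.pred))
    (hK.isNearest (s.aux - η • gradEstimate K η δ f j s)) hu
  have e : gradEstimate K η δ f j s - s.pred
      = ((d : ℝ) * (fdVec f δ (centerPoint K η s) j - s.pred j)) • basisVec j := by
    rw [gradEstimate_eq, add_sub_cancel_left]
  rw [e] at h
  exact h

/-- Used for the last round, after which there is no further loss with which to form a potential. -/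
theorem sum_inner_gradEstimate_le_potential {d : ℕ} {X K : Set (Vec d)} {δ η : ℝ}
    (hK : IsInnerSet X K δ) (hη : 0 < η) (f : Vec d → ℝ) {u : Vec d} (hu : u ∈ K)
    (s : LearnerState d) :
    ∑ j, inner ℝ (gradEstimate K η δ f j s) (centerPoint K η s - u)
      ≤ d * potential K η δ u f s := by
  have h : ∀ j : Fin d, inner ℝ (gradEstimate K η δ f j s) (centerPoint K η s - u)
      ≤ ‖s.aux - u‖ ^ 2 / (2 * η) - ‖centerPoint K η s - s.aux‖ ^ 2 / (2 * η)
        + η * ‖((d : ℝ) * (fdVec f δ (centerPoint K η s) j - s.pred j)) •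
            (basisVec j : Vec d)‖ ^ 2 := by
    intro j
    have h1 := inner_gradEstimate_le hK hη f hu s j
    have h2 : 0 ≤ ‖(learnerStep K η δ f j s).aux - u‖ ^ 2 / (2 * η) := by positivity
    have h3 : 0 ≤ ‖(learnerStep K η δ f j s).aux - centerPoint K η s‖ ^ 2 / (4 * η) := by
      positivity
    rw [sub_div] at h1
    linarith
  refine (Finset.sum_le_sum fun j _ => h j).trans ?_
  rw [Finset.sum_add_distrib, ← Finset.mul_sum, sum_norm_sq_coordEstimate, potential]
  simp only [Finset.sum_const, Finset.card_univ, Fintype.card_fin, nsmul_eq_mul]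
  have hd : (d : ℝ) ^ 2 ≤ 2 * d ^ 3 := by
    rcases Nat.eq_zero_or_pos d with h0 | h0
    · simp [h0]
    · have : (1 : ℝ) ≤ d := by exact_mod_cast h0
      nlinarith [sq_nonneg (d : ℝ)]
  have h5 := mul_le_mul_of_nonneg_left hd
    (show 0 ≤ η * ‖fdVec f δ (centerPoint K η s) - s.pred‖ ^ 2 by positivity)
  linarith

/-- The heart of the proof. Young's inequality with parameter `1/(2d)` weakens the contraction `1 -
1/d` of the prediction error to at most `1 - 1/(2d)`. With weight `2 η d²` this still releases `η d
‖v - m‖²`, the average variance term. The next center `z` is determined by the next state, so the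
potential can carry its movement from `p.aux` in advance. -/
theorem sum_inner_gradEstimate_add_potential_le {d : ℕ} {X K : Set (Vec d)} {L β δ η G : ℝ}
    {f g : Vec d → ℝ} (hX : Convex ℝ X) (hK : IsInnerSet X K δ) (hf : IsSmoothLoss X L β f)
    (hg : IsSmoothLoss X L β g) (hδ : 0 < δ) (hβ : 0 < β) (hη : 0 < η)
    (hstep : 144 * (η ^ 2 * β ^ 2 * d ^ 3) ≤ 1)
    (hG : ∀ x ∈ X, ‖gradientWithin g X x - gradientWithin f X x‖ ^ 2 ≤ G) {u : Vec d}
    (hu : u ∈ K) (s : LearnerState d) (hd : 1 ≤ d) :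
    ∑ j, (inner ℝ (gradEstimate K η δ f j s) (centerPoint K η s - u)
        + potential K η δ u g (learnerStep K η δ f j s))
      ≤ d * (potential K η δ u f s + 24 * η * d ^ 3 * (2 * (d * (β * δ) ^ 2) + G)) := by
  have hd1 : (1 : ℝ) ≤ d := by exact_mod_cast hd
  have hd0 : (0 : ℝ) < d := by linarith
  have hy : centerPoint K η s ∈ K := (hK.isNearest _).1
  have h : ∀ j : Fin d, inner ℝ (gradEstimate K η δ f j s) (centerPoint K η s - u)
        + potential K η δ u g (learnerStep K η δ f j s)
      ≤ (‖s.aux - u‖ ^ 2 / (2 * η) - ‖centerPoint K η s - s.aux‖ ^ 2 / (2 * η)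
          + 24 * η * d ^ 3 * (2 * (d * (β * δ) ^ 2) + G))
        + η * ‖((d : ℝ) * (fdVec f δ (centerPoint K η s) j - s.pred j)) •
            (basisVec j : Vec d)‖ ^ 2
        + η * (2 * d ^ 2 + d) * ‖fdVec f δ (centerPoint K η s) - (s.pred +
            (fdVec f δ (centerPoint K η s) j - s.pred j) • basisVec j)‖ ^ 2 := by
    intro j
    have h1 := inner_gradEstimate_le hK hη f hu s j
    have hpred : (learnerStep K η δ f j s).pred = s.pred +
        (fdVec f δ (centerPoint K η s) j - s.pred j) • basisVec j := rfl
    rw [← hpred]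
    unfold potential
    set p := learnerStep K η δ f j s
    set y := centerPoint K η s
    set z := centerPoint K η p
    have hz : z ∈ K := (hK.isNearest _).1
    have h2 := norm_fdVec_sub_fdVec_sq_le hX hK hf hg hδ hβ hG hy hz
    -- The remaining Young factor is `1 + 2d ≤ 3d`; with the weight `2 η d²` and the 4 of `h2` it
    -- gives the constant `24 η d³`.
    have h3 := norm_add_sq_le_young (show (0 : ℝ) < 1 / (2 * d) by positivity)
      (fdVec f δ y - p.pred) (fdVec g δ z - fdVec f δ y)
    have h4 := norm_add_sq_le_young (show (0 : ℝ) < 2 by norm_num) (z - p.aux) (p.aux - y)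
    rw [sub_add_sub_cancel] at h4
    rw [add_comm (fdVec f δ y - p.pred), sub_add_sub_cancel, one_div_one_div] at h3
    have hG0 : 0 ≤ G := (sq_nonneg _).trans (hG y (hK.subset hy))
    have h5 : ‖fdVec g δ z - p.pred‖ ^ 2 ≤ (1 + 1 / (2 * d)) * ‖fdVec f δ y - p.pred‖ ^ 2
        + 3 * d * (4 * (2 * (d * (β * δ) ^ 2) + G + β ^ 2 * ‖z - y‖ ^ 2)) := by
      refine h3.trans (add_le_add le_rfl ?_)
      exact mul_le_mul (by linarith) h2 (sq_nonneg _) (by positivity)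
    have h6 := mul_le_mul_of_nonneg_left h5 (show 0 ≤ 2 * η * (d : ℝ) ^ 2 by positivity)
    have e1 : 2 * η * (d : ℝ) ^ 2 * ((1 + 1 / (2 * d)) * ‖fdVec f δ y - p.pred‖ ^ 2
        + 3 * d * (4 * (2 * (d * (β * δ) ^ 2) + G + β ^ 2 * ‖z - y‖ ^ 2)))
        = η * (2 * d ^ 2 + d) * ‖fdVec f δ y - p.pred‖ ^ 2
          + 24 * η * d ^ 3 * (2 * (d * (β * δ) ^ 2) + G)
          + 24 * η * d ^ 3 * β ^ 2 * ‖z - y‖ ^ 2 := by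
      field_simp
      ring
    have h7 : 24 * η * d ^ 3 * β ^ 2 * ‖z - y‖ ^ 2
        ≤ ‖z - p.aux‖ ^ 2 / (2 * η) + ‖p.aux - y‖ ^ 2 / (4 * η) := by
      -- Here `144 = 24 * 6`. The factor `1 / (6η)` turns the Young weights `3` and `3/2` of `h4`
      -- into exactly the available `1/(2η)` and `1/(4η)`.
      have h8 : 24 * η * d ^ 3 * β ^ 2 ≤ 1 / (6 * η) := by
        rw [le_div_iff₀ (by positivity)]
        linarith
      calc 24 * η * d ^ 3 * β ^ 2 * ‖z - y‖ ^ 2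
          ≤ 1 / (6 * η) * ((1 + 2) * ‖z - p.aux‖ ^ 2 + (1 + 1 / 2) * ‖p.aux - y‖ ^ 2) :=
            mul_le_mul h8 h4 (sq_nonneg _) (by positivity)
        _ = _ := by
            field_simp
            ring
    rw [sub_div] at h1
    linarith
  refine (Finset.sum_le_sum fun j _ => h j).trans ?_
  rw [Finset.sum_add_distrib, Finset.sum_add_distrib, ← Finset.mul_sum, ← Finset.mul_sum,
    sum_norm_sq_coordEstimate, sum_norm_sq_coordUpdate, potential]
  simp only [Finset.sum_const, Finset.card_univ, Fintype.card_fin, nsmul_eq_mul]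
  -- The coefficients of the prediction error add up to `η d² + η (2d² + d)(d - 1) = 2 η d³ - η d`.
  have h9 : 0 ≤ η * d * ‖fdVec f δ (centerPoint K η s) - s.pred‖ ^ 2 := by positivity
  linarith

theorem sum_loss_sub_le {d : ℕ} {X K : Set (Vec d)} {L β δ D α : ℝ} {f : Vec d → ℝ}
    (hX : Convex ℝ X) (hK : IsInnerSet X K δ) (hf : IsSmoothLoss X L β f) (hL : 0 ≤ L)
    (hδ : 0 < δ) (hβ : 0 < β) (hα : 0 ≤ α) (hD : ∀ x ∈ X, ∀ y ∈ X, ‖x - y‖ ≤ D)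
    (h0 : (0 : Vec d) ∈ X) {x : Vec d} (hx : x ∈ X) (hu : (1 - α) • x ∈ K) (η : ℝ)
    (s : LearnerState d) :
    ∑ j, (f (centerPoint K η s + δ • basisVec j) - f x)
      ≤ ∑ j, inner ℝ (gradEstimate K η δ f j s) (centerPoint K η s - (1 - α) • x)
        + d * (L * δ + L * (α * D) + √d * (β * δ) * D) := by
  set y := centerPoint K η s
  set u := (1 - α) • x
  have hy : y ∈ K := (hK.isNearest _).1
  have hyX := hK.subset hy
  have huX := hK.subset hu
  have h1 : ∀ j, f (y + δ • basisVec j) ≤ f y + L * δ := by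
    intro j
    have h := hf.lipschitz _ (hK.add_mem y hy j) y hyX
    have hb : ‖(basisVec j : Vec d)‖ = 1 := by simp [basisVec]
    rw [add_sub_cancel_left, norm_smul, hb, mul_one, Real.norm_of_nonneg hδ.le] at h
    linarith [le_abs_self (f (y + δ • basisVec j) - f y)]
  have h2 : f u ≤ f x + L * (α * D) := by
    have h := hf.lipschitz u huX x hx
    have e : u - x = -(α • x) := by simp only [u]; module
    rw [e, norm_neg, norm_smul, Real.norm_of_nonneg hα] at h
    have hxD : ‖x‖ ≤ D := by simpa using hD x hx 0 h0
    have h' := mul_le_mul_of_nonneg_left (mul_le_mul_of_nonneg_left hxD hα) hL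
    linarith [le_abs_self (f u - f x)]
  have h3 := hf.sub_le_inner hX hyX huX
  have h4 : inner ℝ (gradientWithin f X y) (y - u)
      ≤ inner ℝ (fdVec f δ y) (y - u) + √d * (β * δ) * D := by
    have h5 := hf.norm_fdVec_sub_sq_le hX hδ hβ (hK.add_mem y hy) (hK.sub_mem y hy)
    have h6 : ‖fdVec f δ y - gradientWithin f X y‖ ≤ √d * (β * δ) := by
      refine abs_le_of_sq_le_sq' ?_ (by positivity) |>.2
      rw [mul_pow, Real.sq_sqrt (by positivity)]
      exact h5
    have h7 := real_inner_le_norm (gradientWithin f X y - fdVec f δ y) (y - u)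
    rw [norm_sub_rev, inner_sub_left] at h7
    have h8 := mul_le_mul h6 (hD y hyX u huX) (norm_nonneg _) (by positivity)
    linarith
  have h9 : ∑ j, inner ℝ (gradEstimate K η δ f j s) (y - u) = d * inner ℝ (fdVec f δ y) (y - u) :=
    sum_inner_coordEstimate s.pred (fdVec f δ y) (y - u)
  rw [h9]
  calc _ ≤ ∑ _j : Fin d, (inner ℝ (fdVec f δ y) (y - u)
        + (L * δ + L * (α * D) + √d * (β * δ) * D)) :=
        Finset.sum_le_sum fun j _ => by linarith [h1 j]
    _ = _ := by simp; ring

/-- With `α = δ / r`, a point `(1 - α) z + δ v` is the convex combination `(1 - α) z + α (r v)` of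
points of `X` whenever `‖v‖ ≤ 1`. -/
theorem IsInnerSet.of_shrunkSet {d : ℕ} {X : Set (Vec d)} {r δ : ℝ} (hX : Convex ℝ X)
    (hcl : IsClosed X) (hr : 0 < r) (hball : Metric.closedBall 0 r ⊆ X) (hδ : 0 < δ)
    (hδr : δ ≤ r / 2) : IsInnerSet X (shrunkSet X r δ) δ := by
  have h0 : (0 : Vec d) ∈ X := hball (by simp [hr.le])
  have hα0 : 0 ≤ δ / r := by positivity
  have hα : δ / r ≤ 1 / 2 := by
    rw [div_le_div_iff₀ hr two_pos]
    linarith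
  have hmem : ∀ y ∈ shrunkSet X r δ, ∀ v : Vec d, ‖v‖ ≤ 1 → y + δ • v ∈ X := by
    rintro _ ⟨z, hz, rfl⟩ v hv
    have hv' : r • v ∈ X := hball (by
      rw [mem_closedBall_zero_iff, norm_smul, Real.norm_of_nonneg hr.le]
      exact mul_le_of_le_one_right hr.le hv)
    have h := hX hz hv' (show 0 ≤ 1 - δ / r by linarith) hα0 (by ring)
    rw [smul_smul, div_mul_cancel₀ _ hr.ne'] at h
    exact h
  have hb : ∀ i, ‖(basisVec i : Vec d)‖ = 1 := fun i => by simp [basisVec]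
  refine ⟨hX.smul _, hcl.smul_of_ne_zero (by linarith), ⟨0, 0, h0, by simp⟩, fun y hy => ?_,
    fun y hy i => hmem y hy _ (hb i).le, fun y hy i => ?_⟩
  · simpa using hmem y hy 0 (by simp)
  · simpa [sub_eq_add_neg] using hmem y hy (-basisVec i) (by simp [hb])

/-! ### Regret -/

/-- The maximal squared gradient change `max_{x ∈ X} ‖∇f_t(x) - ∇f_{t-1}(x)‖²`. -/
noncomputable def gradChange {d : ℕ} (X : Set (Vec d)) (f : ℕ → Vec d → ℝ) (t : ℕ) : ℝ :=
  sSup ((fun x => ‖gradientWithin (f t) X x - gradientWithin (f (t - 1)) X x‖ ^ 2) '' X)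

theorem gradChange_nonneg {d : ℕ} (X : Set (Vec d)) (f : ℕ → Vec d → ℝ) (t : ℕ) :
    0 ≤ gradChange X f t := by
  refine Real.sSup_nonneg ?_
  rintro _ ⟨x, _, rfl⟩
  exact sq_nonneg _

/-- The point is that the supremum is over a bounded set (otherwise `sSup` would be the default 0):
both gradients are `β`-Lipschitz on a set of diameter at most `D`. -/
theorem le_gradChange {d : ℕ} {X : Set (Vec d)} {L β D : ℝ} {f : ℕ → Vec d → ℝ} {t : ℕ}
    (h1 : IsSmoothLoss X L β (f t)) (h2 : IsSmoothLoss X L β (f (t - 1))) (hβ : 0 < β)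
    (hD : ∀ x ∈ X, ∀ y ∈ X, ‖x - y‖ ≤ D) {x : Vec d} (hx : x ∈ X) :
    ‖gradientWithin (f t) X x - gradientWithin (f (t - 1)) X x‖ ^ 2 ≤ gradChange X f t := by
  refine le_csSup ⟨(β * D + ‖gradientWithin (f t) X x - gradientWithin (f (t - 1)) X x‖
    + β * D) ^ 2, ?_⟩ ⟨x, hx, rfl⟩
  rintro _ ⟨y, hy, rfl⟩
  refine pow_le_pow_left₀ (norm_nonneg _) ?_ 2
  have e : gradientWithin (f t) X y - gradientWithin (f (t - 1)) X y
      = (gradientWithin (f t) X y - gradientWithin (f t) X x)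
        + (gradientWithin (f t) X x - gradientWithin (f (t - 1)) X x)
        + (gradientWithin (f (t - 1)) X x - gradientWithin (f (t - 1)) X y) := by abel
  rw [e]
  refine (norm_add₃_le).trans ?_
  gcongr
  · exact (h1.smooth y hy x hx).trans (mul_le_mul_of_nonneg_left (hD y hy x hx) hβ.le)
  · exact (h2.smooth x hx y hy).trans (mul_le_mul_of_nonneg_left (hD x hx y hy) hβ.le)

theorem potential_le {d : ℕ} {X K : Set (Vec d)} {L β δ η D : ℝ} {f : Vec d → ℝ}
    (hK : IsInnerSet X K δ) (hf : IsSmoothLoss X L β f) (hδ : 0 < δ) (hη : 0 < η)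
    (hD : ∀ x ∈ X, ∀ y ∈ X, ‖x - y‖ ≤ D) (hd : 1 ≤ d) {u : Vec d} (hu : u ∈ K)
    {s : LearnerState d} (hs : s.aux ∈ K) (hm : ‖s.pred‖ ≤ L) :
    potential K η δ u f s ≤ D ^ 2 / (2 * η) + 8 * η * d ^ 3 * L ^ 2 := by
  have hd1 : (1 : ℝ) ≤ d := by exact_mod_cast hd
  have hy : centerPoint K η s ∈ K := (hK.isNearest _).1
  have h1 := hf.norm_fdVec_sq_le hδ (hK.add_mem _ hy) (hK.sub_mem _ hy)
  have h2 := norm_add_sq_le_young one_pos (fdVec f δ (centerPoint K η s)) (-s.pred)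
  rw [norm_neg, ← sub_eq_add_neg] at h2
  have h3 : ‖s.pred‖ ^ 2 ≤ d * L ^ 2 :=
    (pow_le_pow_left₀ (norm_nonneg _) hm 2).trans (le_mul_of_one_le_left (sq_nonneg _) hd1)
  have h4 : ‖fdVec f δ (centerPoint K η s) - s.pred‖ ^ 2 ≤ 4 * (d * L ^ 2) := by linarith
  have h5 := mul_le_mul_of_nonneg_left h4 (show 0 ≤ 2 * η * (d : ℝ) ^ 2 by positivity)
  have h6 : ‖s.aux - u‖ ^ 2 / (2 * η) ≤ D ^ 2 / (2 * η) :=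
    div_le_div_of_nonneg_right (pow_le_pow_left₀ (norm_nonneg _)
      (hD _ (hK.subset hs) _ (hK.subset hu)) 2) (by positivity)
  have h7 : 0 ≤ ‖centerPoint K η s - s.aux‖ ^ 2 / (2 * η) := by positivity
  unfold potential
  linarith

theorem sum_regret_le {d T : ℕ} {X K : Set (Vec d)} {L β δ η D α : ℝ} {f : ℕ → Vec d → ℝ}
    (hX : Convex ℝ X) (hK : IsInnerSet X K δ) (hf : ∀ t ≤ T, IsSmoothLoss X L β (f t))
    (hδ : 0 < δ) (hβ : 0 < β) (hη : 0 < η) (hα : 0 ≤ α)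
    (hstep : 144 * (η ^ 2 * β ^ 2 * d ^ 3) ≤ 1)
    (hD : ∀ x ∈ X, ∀ y ∈ X, ‖x - y‖ ≤ D) (h0 : (0 : Vec d) ∈ X) (hT : 1 ≤ T) {x : Vec d}
    (hx : x ∈ X) (hu : (1 - α) • x ∈ K) {y₁ m₁ : Vec d} (hy₁ : y₁ ∈ K) (hm₁ : ‖m₁‖ ≤ L)
    (j₀ : Fin d) :
    ∑ ι : Finset.Icc 1 T → Fin d, (∑ t ∈ Finset.Icc 1 T,
        (f t (playedPoint K η δ f ⟨y₁, m₁⟩ (extendChoice j₀ ι) t) - f t x))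
      ≤ Fintype.card (Finset.Icc 1 T → Fin d) * (D ^ 2 / (2 * η) + 8 * η * d ^ 3 * L ^ 2
        + T * (L * δ + L * (α * D) + √d * (β * δ) * D + 24 * η * d ^ 3 * (2 * (d * (β * δ) ^ 2)))
        + 24 * η * d ^ 3 * gradVariation X f T) := by
  have hL : 0 ≤ L := (norm_nonneg _).trans hm₁
  have hd : 1 ≤ d := j₀.pos
  have hgc : ∀ t, 0 ≤ 24 * η * (d : ℝ) ^ 3 * gradChange X f t := fun t =>
    mul_nonneg (by positivity) (gradChange_nonneg X f t)
  have main := sum_cost_le_of_potential j₀ K η δ f ⟨y₁, m₁⟩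
    (fun t s j => f t (centerPoint K η s + δ • basisVec j) - f t x)
    -- Round `t` produces the gradient change of index `t + 1`; subtracting the change of index `t`
    -- inside the potential shifts it into `c t`. The potential is cut off to 0 after round `T`.
    (fun t s => if t ≤ T then potential K η δ ((1 - α) • x) (f t) s
      - 24 * η * d ^ 3 * gradChange X f t else 0)
    (fun t => (L * δ + L * (α * D) + √d * (β * δ) * D
      + 24 * η * d ^ 3 * (2 * (d * (β * δ) ^ 2))) + 24 * η * d ^ 3 * gradChange X f t)
    (T := T) ?_ T le_rfl
  · simp only [if_pos hT, if_neg (show ¬ T + 1 ≤ T by omega), add_zero] at main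
    refine main.trans ?_
    rw [Finset.sum_const, Finset.card_univ, nsmul_eq_mul]
    refine mul_le_mul_of_nonneg_left ?_ (Nat.cast_nonneg _)
    have h1 := potential_le hK (hf 1 hT) hδ hη hD hd hu (s := ⟨y₁, m₁⟩) hy₁ hm₁
    have h2 := hgc 1
    have h3 : gradVariation X f T = ∑ t ∈ Finset.Icc 1 T, gradChange X f t := rfl
    rw [Finset.sum_add_distrib, ← Finset.mul_sum, ← h3, Finset.sum_const, Nat.card_Icc,
      nsmul_eq_mul, Nat.add_sub_cancel]
    linarith
  · intro t ht s
    obtain ⟨_, htT⟩ := Finset.mem_Icc.1 ht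
    have h1 := sum_loss_sub_le hX hK (hf t htT) hL hδ hβ hα hD h0 hx hu η s
    have hcard : 0 ≤ (d : ℝ) * (24 * η * d ^ 3 * (2 * (d * (β * δ) ^ 2))) := by positivity
    rw [Finset.sum_add_distrib]
    simp only [if_pos htT]
    by_cases h : t + 1 ≤ T
    · simp only [if_pos h]
      have hnext := hf (t + 1) h
      have h2 := sum_inner_gradEstimate_add_potential_le hX hK (hf t htT) hnext hδ hβ hη hstep
        (G := gradChange X f (t + 1))
        (fun z hz => le_gradChange (t := t + 1) hnext (hf t htT) hβ hD hz) hu s hd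
      rw [Finset.sum_add_distrib] at h2
      rw [Finset.sum_sub_distrib (fun j => potential K η δ ((1 - α) • x) (f (t + 1))
          (learnerStep K η δ (f t) j s)),
        Finset.sum_const, Finset.card_univ, Fintype.card_fin, nsmul_eq_mul]
      linarith
    · simp only [if_neg h, Finset.sum_const_zero, add_zero]
      have h2 := sum_inner_gradEstimate_le_potential hK hη (f t) hu s
      linarith

theorem coordRegret_congr {d T : ℕ} (X : Set (Vec d)) (r η δ : ℝ) (f : ℕ → Vec d → ℝ)
    (y₁ m₁ : Vec d) {ι ι' : ℕ → Fin d} (h : ∀ t ∈ Finset.Icc 1 T, ι t = ι' t) :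
    coordRegret X r η δ f y₁ m₁ T ι = coordRegret X r η δ f y₁ m₁ T ι' := by
  unfold coordRegret
  congr 1
  refine Finset.sum_congr rfl fun t ht => ?_
  have ht' := Finset.mem_Icc.1 ht
  rw [playedPoint, playedPoint, h t ht, roundState_congr fun s h1 h2 =>
    h s (Finset.mem_Icc.2 ⟨h1, by omega⟩)]

/-- A bound on the average regret against each fixed comparator value passes to the infimum, because
the infimum does not depend on the sampled coordinates. -/
theorem average_sub_sInf_le {γ : Type*} [Fintype γ] [Nonempty γ] {S : γ → ℝ} {A : Set ℝ} {B : ℝ}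
    (hA : A.Nonempty) (h : ∀ a ∈ A, ∑ c, (S c - a) ≤ Fintype.card γ * B) :
    (Fintype.card γ : ℝ)⁻¹ * ∑ c, (S c - sInf A) ≤ B := by
  have hN : (0 : ℝ) < Fintype.card γ := by exact_mod_cast Fintype.card_pos
  have h' : ∀ a : ℝ, ∑ c, (S c - a) = ∑ c, S c - Fintype.card γ * a := fun a => by
    rw [Finset.sum_sub_distrib, Finset.sum_const, Finset.card_univ, nsmul_eq_mul]
  have hle : (Fintype.card γ : ℝ)⁻¹ * ∑ c, S c - B ≤ sInf A := by
    refine le_csInf hA fun a ha => ?_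
    have h1 := h a ha
    rw [h'] at h1
    rw [sub_le_iff_le_add, inv_mul_le_iff₀ hN]
    linarith
  rw [h', mul_sub, inv_mul_cancel_left₀ hN.ne']
  linarith

/-! ### The oracle parameters -/

theorem oracleStep_facts {d T : ℕ} (hd : 1 ≤ d) (hT : 2 ≤ T) {D β V : ℝ} (hD : 0 < D)
    (hβ : 0 < β) (hV : 0 ≤ V) :
    0 < oracleStep d T D β V ∧ 4 * oracleStep d T D β V * (d : ℝ) ^ 2 * √(V + 1) ≤ D ∧
      144 * (oracleStep d T D β V ^ 2 * β ^ 2 * d ^ 3) ≤ 1 ∧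
      1 / oracleStep d T D β V
        ≤ 4 * d ^ 2 * √(V + 1) / D + 16 * β * d ^ 2 * √(Real.log T) := by
  have hd1 : (1 : ℝ) ≤ d := by exact_mod_cast hd
  have hd0 : (0 : ℝ) < d := by linarith
  have hW : 0 < √(V + 1) := by positivity
  have hlog : (0.69 : ℝ) ≤ Real.log T := by
    have h1 : Real.log 2 ≤ Real.log T := Real.log_le_log two_pos (by exact_mod_cast hT)
    have := Real.log_two_gt_d9
    linarith
  have hl : 0 < √(Real.log T) := by apply Real.sqrt_pos.2; linarith
  have hp : (0 : ℝ) < (d : ℝ) ^ ((3 : ℝ) / 2) := by positivity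
  have hp2 : ((d : ℝ) ^ ((3 : ℝ) / 2)) ^ 2 = d ^ 3 := by
    rw [← Real.rpow_natCast, ← Real.rpow_mul hd0.le]
    norm_num
  have hp3 : (d : ℝ) ^ ((3 : ℝ) / 2) ≤ d ^ 2 := by
    rw [← Real.rpow_natCast]
    exact Real.rpow_le_rpow_of_exponent_le hd1 (by norm_num)
  have hpos : 0 < oracleStep d T D β V := lt_min (by positivity) (by positivity)
  have h1 : oracleStep d T D β V ≤ D / (4 * (d : ℝ) ^ 2 * √(V + 1)) := min_le_left _ _
  have h2 : oracleStep d T D β V ≤ 1 / (16 * β * (d : ℝ) ^ ((3 : ℝ) / 2) * √(Real.log T)) :=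
    min_le_right _ _
  refine ⟨hpos, ?_, ?_, ?_⟩
  · rw [le_div_iff₀ (by positivity)] at h1
    linarith
  · rw [le_div_iff₀ (by positivity)] at h2
    have h3 := pow_le_pow_left₀ (by positivity) h2 2
    have e : (oracleStep d T D β V * (16 * β * (d : ℝ) ^ ((3 : ℝ) / 2) * √(Real.log T))) ^ 2
        = 256 * Real.log T * (oracleStep d T D β V ^ 2 * β ^ 2 * d ^ 3) := by
      rw [mul_pow, mul_pow, mul_pow, hp2, Real.sq_sqrt (by linarith)]
      ring
    rw [e, one_pow] at h3
    refine le_trans ?_ h3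
    -- `256 log T ≥ 256 * 0.69 > 144`; this is where `T ≥ 2` enters.
    exact mul_le_mul_of_nonneg_right (by linarith) (by positivity)
  · have h3 : 1 / oracleStep d T D β V ≤ 4 * d ^ 2 * √(V + 1) / D
        + 16 * β * (d : ℝ) ^ ((3 : ℝ) / 2) * √(Real.log T) := by
      rcases min_choice (D / (4 * (d : ℝ) ^ 2 * √(V + 1)))
        (1 / (16 * β * (d : ℝ) ^ ((3 : ℝ) / 2) * √(Real.log T))) with h | h
      · rw [oracleStep, h, one_div_div]
        have : 0 ≤ 16 * β * (d : ℝ) ^ ((3 : ℝ) / 2) * √(Real.log T) := by positivity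
        linarith
      · rw [oracleStep, h, one_div_one_div]
        have : 0 ≤ 4 * d ^ 2 * √(V + 1) / D := by positivity
        linarith
    refine h3.trans ?_
    gcongr

theorem oracleRadius_facts {T : ℕ} (hT : 2 ≤ T) {r β V : ℝ} (hr : 0 < r) (hβ : 0 < β)
    (hV : 0 ≤ V) :
    0 < oracleRadius T r β V ∧ oracleRadius T r β V ≤ r / 2 ∧
      T * (β * oracleRadius T r β V) ≤ √(V + 1) ∧ T * (β * oracleRadius T r β V) ^ 2 ≤ 1 := by
  have hT0 : (0 : ℝ) < T := by exact_mod_cast (by omega : 0 < T)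
  have hpos : 0 < oracleRadius T r β V :=
    lt_min (by positivity) (lt_min (by positivity) (by positivity))
  have h1 : oracleRadius T r β V ≤ √(V + 1) / (β * T) := min_le_left _ _
  have h2 : oracleRadius T r β V ≤ 1 / (β * √T) := (min_le_right _ _).trans (min_le_left _ _)
  have h3 : oracleRadius T r β V ≤ r / 2 := (min_le_right _ _).trans (min_le_right _ _)
  refine ⟨hpos, h3, ?_, ?_⟩
  · rw [le_div_iff₀ (by positivity)] at h1
    linarith
  · rw [le_div_iff₀ (by positivity)] at h2
    have h4 := pow_le_pow_left₀ (by positivity) h2 2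
    have e : (oracleRadius T r β V * (β * √T)) ^ 2 = T * (β * oracleRadius T r β V) ^ 2 := by
      rw [mul_pow, mul_pow, mul_pow, Real.sq_sqrt hT0.le]
      ring
    rwa [e, one_pow] at h4

theorem regret_bound_le {d T : ℕ} (hd : 1 ≤ d) (hT : 2 ≤ T) {r L β D V : ℝ} (hr : 0 < r)
    (hβ : 0 < β) (hL : 0 ≤ L) (hrD : 2 * r ≤ D) (hV : 0 ≤ V) :
    D ^ 2 / (2 * oracleStep d T D β V) + 8 * oracleStep d T D β V * d ^ 3 * L ^ 2
        + T * (L * oracleRadius T r β V + L * (oracleRadius T r β V / r * D)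
          + √d * (β * oracleRadius T r β V) * D
          + 24 * oracleStep d T D β V * d ^ 3 * (2 * (d * (β * oracleRadius T r β V) ^ 2)))
        + 24 * oracleStep d T D β V * d ^ 3 * V
      ≤ 40 * (1 + L ^ 2 + β * D + L / (β * r)) * Real.log T ^ 1
          * (D * (d : ℝ) ^ 2 * √(V + 1)) := by
  have hD : 0 < D := by linarith
  obtain ⟨hη, hη1, -, hη3⟩ := oracleStep_facts hd hT hD hβ hV
  obtain ⟨hδ, -, hδ1, hδ2⟩ := oracleRadius_facts hT hr hβ hV
  set η := oracleStep d T D β V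
  set δ := oracleRadius T r β V
  have hd1 : (1 : ℝ) ≤ d := by exact_mod_cast hd
  have hd0 : (0 : ℝ) < d := by linarith
  have hW : 1 ≤ √(V + 1) := Real.one_le_sqrt.2 (by linarith)
  have hWsq : √(V + 1) ^ 2 = V + 1 := Real.sq_sqrt (by linarith)
  have hlog : (0.69 : ℝ) ≤ Real.log T := by
    have h1 : Real.log 2 ≤ Real.log T := Real.log_le_log two_pos (by exact_mod_cast hT)
    have := Real.log_two_gt_d9
    linarith
  have hsl : √(Real.log T) ≤ 2 * Real.log T := by
    rw [Real.sqrt_le_left (by linarith)]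
    nlinarith
  set W := √(V + 1)
  set l := Real.log T
  have hW0 : 0 < W := by linarith
  set P := D * (d : ℝ) ^ 2 * W with hP
  have hP0 : 0 < P := by positivity
  have hdP : D * (d : ℝ) ^ 2 ≤ P := le_mul_of_one_le_right (by positivity) hW
  have hDP : D * W ≤ P := by
    rw [hP]
    gcongr
    exact le_mul_of_one_le_right hD.le (one_le_pow₀ hd1)
  have hηd : 4 * η * (d : ℝ) ^ 2 ≤ D :=
    (le_mul_of_one_le_right (by positivity) hW).trans hη1
  have t1 : D ^ 2 / (2 * η) ≤ 2 * P + β * D * (16 * l) * P := by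
    have h1 := mul_le_mul_of_nonneg_left hη3 (show 0 ≤ D ^ 2 / 2 by positivity)
    have e1 : D ^ 2 / 2 * (1 / η) = D ^ 2 / (2 * η) := by field_simp
    have e2 : D ^ 2 / 2 * (4 * d ^ 2 * W / D + 16 * β * d ^ 2 * √l)
        = 2 * P + β * D * (8 * √l) * (D * d ^ 2) := by
      rw [hP]
      field_simp
      ring
    rw [e1, e2] at h1
    refine h1.trans (add_le_add le_rfl ?_)
    exact mul_le_mul (mul_le_mul_of_nonneg_left (by linarith) (by positivity)) hdP
      (by positivity) (by positivity)
  have t2 : 8 * η * d ^ 3 * L ^ 2 ≤ 2 * L ^ 2 * P := by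
    have h1 := mul_le_mul_of_nonneg_left hηd (show 0 ≤ 2 * L ^ 2 * d by positivity)
    have h2 : D * (d : ℝ) ≤ P := le_trans (mul_le_mul_of_nonneg_left
      (le_self_pow₀ hd1 two_ne_zero) hD.le) hdP
    have h3 := mul_le_mul_of_nonneg_left h2 (show 0 ≤ 2 * L ^ 2 by positivity)
    linarith
  have t3 : T * (L * δ) ≤ L / (β * r) * P := by
    have h1 := mul_le_mul_of_nonneg_left hδ1 (show 0 ≤ L / β by positivity)
    have e1 : L / β * (T * (β * δ)) = T * (L * δ) := by field_simp
    have h2 : r * W ≤ P := (mul_le_mul_of_nonneg_right (by linarith) hW0.le).trans hDP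
    have h3 := mul_le_mul_of_nonneg_left h2 (show 0 ≤ L / (β * r) by positivity)
    have e2 : L / (β * r) * (r * W) = L / β * W := by field_simp
    linarith
  have t4 : T * (L * (δ / r * D)) ≤ L / (β * r) * P := by
    have h1 := mul_le_mul_of_nonneg_left hδ1 (show 0 ≤ L / (β * r) * D by positivity)
    have e1 : L / (β * r) * D * (T * (β * δ)) = T * (L * (δ / r * D)) := by field_simp
    have h3 := mul_le_mul_of_nonneg_left hDP (show 0 ≤ L / (β * r) by positivity)
    linarith
  have t5 : T * (√d * (β * δ) * D) ≤ P := by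
    have h1 : √(d : ℝ) ≤ d ^ 2 := by
      rw [Real.sqrt_le_left (by positivity), ← pow_mul]
      exact le_self_pow₀ hd1 (by norm_num)
    have h2 := mul_le_mul h1 hδ1 (by positivity) (by positivity)
    have h3 := mul_le_mul_of_nonneg_right h2 hD.le
    rw [hP]
    linarith
  have t6 : T * (24 * η * d ^ 3 * (2 * (d * (β * δ) ^ 2))) ≤ 12 * P := by
    have h1 := mul_le_mul_of_nonneg_left hδ2 (show 0 ≤ 48 * η * (d : ℝ) ^ 4 by positivity)
    have h2 := mul_le_mul_of_nonneg_left hηd (show 0 ≤ 12 * (d : ℝ) ^ 2 by positivity)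
    linarith
  have t7 : 24 * η * d ^ 3 * V ≤ 6 * P := by
    have h1 : 24 * η * (d : ℝ) ^ 3 * V ≤ 24 * η * d ^ 3 * W ^ 2 :=
      mul_le_mul_of_nonneg_left (by linarith) (by positivity)
    have h2 := mul_le_mul_of_nonneg_left hη1 (show 0 ≤ 6 * (d : ℝ) * W by positivity)
    have h3 : D * W * (d : ℝ) ≤ D * W * d ^ 2 :=
      mul_le_mul_of_nonneg_left (le_self_pow₀ hd1 two_ne_zero) (by positivity)
    linarith
  have hLβ : 0 ≤ L / (β * r) * P := by positivity
  -- The multiples of `P` free of `L` and `β` in `t1`, `t5`, `t6`, `t7` are `2 + 1 + 12 + 6 = 21`,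
  -- below `40 * 0.69`.
  have f1 : 21 * P ≤ 40 * l * P := mul_le_mul_of_nonneg_right (by linarith) hP0.le
  have f2 : 2 * (L ^ 2 * P) ≤ 40 * l * (L ^ 2 * P) :=
    mul_le_mul_of_nonneg_right (by linarith) (by positivity)
  have f3 : 2 * (L / (β * r) * P) ≤ 40 * l * (L / (β * r) * P) :=
    mul_le_mul_of_nonneg_right (by linarith) (by positivity)
  have f4 : 0 ≤ l * (β * D * P) := mul_nonneg (by linarith) (by positivity)
  rw [pow_one]
  linarith

theorem mainTheorem8 :
    ∃ (C : ℝ) (k : ℕ), 0 < C ∧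
      ∀ (d T : ℕ), 1 ≤ d → 2 ≤ T →
      ∀ (X : Set (Vec d)) (r R L β : ℝ), Convex ℝ X → IsClosed X →
      0 < r → Metric.closedBall 0 r ⊆ X → X ⊆ Metric.closedBall 0 R → 0 < β →
      ∀ (f : ℕ → Vec d → ℝ), (∀ t ≤ T, IsSmoothLoss X L β (f t)) →
      ∀ (D V η δ : ℝ), D = Metric.diam X → V = gradVariation X f T →
      η = oracleStep d T D β V → δ = oracleRadius T r β V →
      ∀ (y₁ m₁ : Vec d), y₁ ∈ shrunkSet X r δ → ‖m₁‖ ≤ L →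
      ∀ (Ω : Type*) [MeasurableSpace Ω] (μ : Measure Ω) [IsProbabilityMeasure μ]
        (i : ℕ → Ω → Fin d),
      (∀ t ∈ Finset.Icc 1 T, Measurable (i t)) →
      iIndepFun (fun t : Finset.Icc 1 T => i t) μ →
      (∀ t ∈ Finset.Icc 1 T, ∀ j : Fin d, μ (i t ⁻¹' {j}) = (d : ℝ≥0∞)⁻¹) →
      Integrable (fun ω => coordRegret X r η δ f y₁ m₁ T (fun t => i t ω)) μ ∧
      ∫ ω, coordRegret X r η δ f y₁ m₁ T (fun t => i t ω) ∂μ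
        ≤ C * (1 + L ^ 2 + β * D + L / (β * r)) * (Real.log T) ^ k
            * (D * (d : ℝ) ^ 2 * √(V + 1)) := by
  refine ⟨40, 1, by norm_num, ?_⟩
  intro d T hd hT X r R L β hX hcl hr hball hXR hβ f hf D V η δ hD hV hη hδ y₁ m₁ hy₁ hm₁ Ω _ μ _
    i him hind hu
  have hbdd : Bornology.IsBounded X := Metric.isBounded_closedBall.subset hXR
  have hDX : ∀ x ∈ X, ∀ y ∈ X, ‖x - y‖ ≤ D := fun x hx y hy => by
    rw [← dist_eq_norm, hD]
    exact Metric.dist_le_diam_of_mem hbdd hx hy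
  have h0 : (0 : Vec d) ∈ X := hball (by simp [hr.le])
  let j₀ : Fin d := ⟨0, hd⟩
  have hL : 0 ≤ L := (norm_nonneg _).trans hm₁
  have hb : ‖(basisVec j₀ : Vec d)‖ = 1 := by simp [basisVec]
  -- The points `± r e` lie in `X`. This makes `D` positive and lets `L / β` be bounded through `L /
  -- (β r) * D`.
  have hrD : 2 * r ≤ D := by
    have hmem : ∀ c : ℝ, |c| = r → c • (basisVec j₀ : Vec d) ∈ X := fun c hc =>
      hball (by simp [norm_smul, hb, hc])
    have h := hDX _ (hmem r (abs_of_pos hr)) _ (hmem (-r) (by rw [abs_neg, abs_of_pos hr]))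
    rwa [← sub_smul, norm_smul, hb, mul_one, sub_neg_eq_add, ← two_mul,
      Real.norm_of_nonneg (by positivity)] at h
  have hV0 : 0 ≤ V := by
    rw [hV]
    exact Finset.sum_nonneg fun t _ => gradChange_nonneg X f t
  obtain ⟨hη0, -, hη2, -⟩ := oracleStep_facts hd hT (by linarith) hβ hV0 (D := D)
  obtain ⟨hδ0, hδr, -, -⟩ := oracleRadius_facts hT hr hβ hV0
  have hbound := regret_bound_le hd hT hr hβ hL hrD hV0
  rw [← hη] at hη0 hη2 hbound
  rw [← hδ] at hδ0 hδr hbound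
  have hK := IsInnerSet.of_shrunkSet hX hcl hr hball hδ0 hδr
  -- The regret reads only the rounds `1, …, T`, so it factors through a finite product and its
  -- integral becomes a finite average; the filler `j₀` is never used.
  have hcongr : ∀ ω, coordRegret X r η δ f y₁ m₁ T (fun t => i t ω)
      = coordRegret X r η δ f y₁ m₁ T
          (extendChoice j₀ fun t : Finset.Icc 1 T => i t ω) := fun ω =>
    coordRegret_congr X r η δ f y₁ m₁ fun t ht =>
      (extendChoice_of_mem j₀ (fun t : Finset.Icc 1 T => i t ω) ht).symm
  obtain ⟨hint, heq⟩ := integral_uniform_choice μ (fun t : Finset.Icc 1 T => i t)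
    (fun t => him t t.2) hind (fun t j => hu t t.2 j)
    (fun x => coordRegret X r η δ f y₁ m₁ T (extendChoice j₀ x))
  simp only [hcongr]
  refine ⟨hint, heq.le.trans (le_trans ?_ hbound)⟩
  have : Nonempty (Finset.Icc 1 T → Fin d) := ⟨fun _ => j₀⟩
  refine average_sub_sInf_le ⟨_, 0, h0, rfl⟩ ?_
  rintro _ ⟨x, hx, rfl⟩
  simp only [← Finset.sum_sub_distrib]
  rw [hV]
  exact sum_regret_le hX hK hf hδ0 hβ hη0 (by positivity) hη2 hDX h0 (by omega) hx
    ⟨x, hx, rfl⟩ hy₁ hm₁ j₀
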